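/- Let $d\ge 2$ and, for $q\in(1,\infty)$, $\rho_b\in(0,\infty)$ and a measurable (scalar- or vector-valued) function $b$ on $\mathbb{R}^d$, put $$\hat b_{q,\rho_b}:=\sup_{0<\rho\le\rho_b}\ \rho\,\sup_{B}\Big(\frac1{|B|}\int_B |b(x)|^{q}\,dx\Big)^{1/q},$$ where the inner supremum is over all open balls $B\subset\mathbb{R}^d$ of radius $\rho$. Lemma 2.8. Let $1<p<p_b<\infty$. There exists a finite constant $N$ depending only on $p$, $p_b$ and $d$ such that, for every $\rho_b\in(0,\infty)$, every measurable $b$ on $\mathbb{R}^d$ with $\hat b_{p_b,\rho_b}<\infty$ and every real-valued $u\in C_0^\infty(\mathbb{R}^d)$, $$\int_{\mathbb{R}^d}|b(x)|^p|u(x)|^p\,dx\ \le\ N\,\hat b_{p_b,\rho_b}^{\,p}\int_{\mathbb{R}^d}|Du(x)|^p\,dx\ +\ N\,\rho_b^{-p}\,\hat b_{p_b,\rho_b}^{\,p}\int_{\mathbb{R}^d}|u(x)|^p\,dx .$$ -/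

import Mathlib

open MeasureTheory
open scoped ENNReal NNReal ContDiff

/-- The normalized norm `(⨍_Γ |f|^q dx)^(1/q)` over a set `Γ ⊆ ℝ^d`, with the average
`⨍_Γ g dx = |Γ|⁻¹ ∫_Γ g dx`, as an extended nonnegative real. -/
noncomputable def avgLpNorm {d : ℕ} {F : Type*} [NormedAddCommGroup F]
    (q : ℝ) (f : EuclideanSpace ℝ (Fin d) → F) (Γ : Set (EuclideanSpace ℝ (Fin d))) : ℝ≥0∞ :=
  (⨍⁻ y in Γ, ‖f y‖ₑ ^ q ∂volume) ^ (1 / q)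

/-- The local Morrey quantity `sup_{0 < ρ ≤ ρb} ρ sup_{B of radius ρ} (⨍_B |b|^q dx)^(1/q)`,
as an extended nonnegative real. -/
noncomputable def localMorrey {d : ℕ} {F : Type*} [NormedAddCommGroup F]
    (q ρb : ℝ) (b : EuclideanSpace ℝ (Fin d) → F) : ℝ≥0∞ :=
  ⨆ ρ ∈ Set.Ioc 0 ρb,
    ENNReal.ofReal ρ * ⨆ x : EuclideanSpace ℝ (Fin d), avgLpNorm q b (Metric.ball x ρ)

/-! Fix `L = ρb / (d + 1)`, `q = pb`, and let `A_k` be averaging over the cubes of side `L / 2 ^ k`.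
The Morrey quantity `K` of `b` gives `A_k |b|^q ≤ (M 2^k)^q` with `M` a constant times `K / ρb`. Let
`W` be the power `p / q < 1` of the dyadic maximal function of `|b|^q`, stopped at generation `n`
and bounded below by a positive constant. As for Coifman–Rochberg weights, `A_k W ≤ C min(W, (M
2^k)^p)` for `k ≤ n`; the core is `gridAvg_dyadicMax_rpow_le`.

Since `W = A_n W`, the integral of `W |v|` can be compared with that of `A_0 W |v|` one generation
at a time. By the `L¹` Poincaré inequality each step costs a multiple of `L 2^{-k} ∫ A_k W |Dv|`
(`lintegral_gridAvg_mul_le_sum`), and `∑ 2^{-k} min(W, (M 2^k)^p)` is at most a multiple of `M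
W^{(p-1)/p}` (`ENNReal.sum_half_pow_mul_min_le`). Taking `v = |u|^p`, Young's inequality lets `∫ W
|u|^p` be absorbed on the left, while `L M` is a multiple of `K`.

The constants do not depend on `n`. Jensen gives `A_n |b|^p ≤ W`; moving `A_n` onto `|u|^p` by
self-adjointness and applying Fatou recovers `|b|^p`. -/

/-! ### Dyadic grids: nesting, convexity and volume of cubes. -/

section GridCubes

variable {d : ℕ} {l : ℝ}

/-- The index of the half-open cube of the lattice `l ℤ^d` which contains `x`. -/
noncomputable def gridIndex (l : ℝ) (x : EuclideanSpace ℝ (Fin d)) : Fin d → ℤ :=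
  fun i => ⌊x i / l⌋

/-- The half-open cube of the lattice `l ℤ^d` which contains `x`. -/
def gridCube (l : ℝ) (x : EuclideanSpace ℝ (Fin d)) : Set (EuclideanSpace ℝ (Fin d)) :=
  {y | gridIndex l y = gridIndex l x}

/-- The average of `f` over the grid cube of side `l` which contains `x`. -/
noncomputable def gridAvg (l : ℝ) (f : EuclideanSpace ℝ (Fin d) → ℝ≥0∞)
    (x : EuclideanSpace ℝ (Fin d)) : ℝ≥0∞ :=
  (ENNReal.ofReal l ^ d)⁻¹ * ∫⁻ y in gridCube l x, f y

/-- A function which is constant on every grid cube of side `l`. -/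
def GridInvariant (l : ℝ) (f : EuclideanSpace ℝ (Fin d) → ℝ≥0∞) : Prop :=
  ∀ x y, gridIndex l x = gridIndex l y → f x = f y

theorem measurable_gridIndex (l : ℝ) :
    Measurable (gridIndex l : EuclideanSpace ℝ (Fin d) → Fin d → ℤ) := by
  refine measurable_pi_lambda _ fun i => Int.measurable_floor.comp ?_
  fun_prop

theorem measurableSet_gridRel (l : ℝ) :
    MeasurableSet {z : EuclideanSpace ℝ (Fin d) × EuclideanSpace ℝ (Fin d) |
      gridIndex l z.1 = gridIndex l z.2} :=
  measurableSet_eq_fun ((measurable_gridIndex l).comp measurable_fst)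
    ((measurable_gridIndex l).comp measurable_snd)

theorem measurableSet_gridCube (l : ℝ) (x : EuclideanSpace ℝ (Fin d)) :
    MeasurableSet (gridCube l x) :=
  measurableSet_eq_fun (measurable_gridIndex l) measurable_const

theorem gridCube_congr {x y : EuclideanSpace ℝ (Fin d)} (h : gridIndex l x = gridIndex l y) :
    gridCube l x = gridCube l y := by
  simp [gridCube, h]

theorem gridIndex_half {x y : EuclideanSpace ℝ (Fin d)}
    (h : gridIndex (l / 2) x = gridIndex (l / 2) y) : gridIndex l x = gridIndex l y := by
  funext i
  have h1 := congrFun h i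
  simp only [gridIndex] at h1 ⊢
  have key : ∀ a : ℝ, ⌊a / l⌋ = ⌊a / (l / 2)⌋ / 2 := fun a => by
    have := Int.floor_div_natCast (a / (l / 2)) 2
    rw [show ((2 : ℕ) : ℤ) = 2 from rfl] at this
    rw [← this]
    congr 1
    -- For `l = 0` both quotients are `0` by the convention for division by zero.
    rcases eq_or_ne l 0 with rfl | hl
    · simp
    · push_cast
      field_simp
  rw [key, key, h1]

theorem gridCube_half_subset (x : EuclideanSpace ℝ (Fin d)) :
    gridCube (l / 2) x ⊆ gridCube l x := fun _ hy => gridIndex_half hy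

theorem abs_sub_lt_of_gridIndex_eq (hl : 0 < l) {x y : EuclideanSpace ℝ (Fin d)}
    (h : gridIndex l x = gridIndex l y) (i : Fin d) : |x i - y i| < l := by
  have h1 := Int.abs_sub_lt_one_of_floor_eq_floor (congrFun h i)
  rw [← sub_div, abs_div, abs_of_pos hl, div_lt_one hl] at h1
  exact h1

theorem norm_sub_le_of_gridIndex_eq (hl : 0 < l) {x y : EuclideanSpace ℝ (Fin d)}
    (h : gridIndex l x = gridIndex l y) : ‖x - y‖ ≤ d * l := by
  have h0 : ‖x - y‖ ≤ ∑ i, ‖(x - y) i‖ := by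
    rw [EuclideanSpace.norm_eq]
    refine Real.sqrt_le_iff.2 ⟨Finset.sum_nonneg fun i _ => norm_nonneg _, ?_⟩
    exact Finset.sum_sq_le_sq_sum_of_nonneg fun i _ => norm_nonneg _
  refine h0.trans ?_
  calc ∑ i, ‖(x - y) i‖ ≤ ∑ _i : Fin d, l :=
        Finset.sum_le_sum fun i _ => (abs_sub_lt_of_gridIndex_eq hl h i).le
    _ = d * l := by simp

theorem gridIndex_lineMap {x y : EuclideanSpace ℝ (Fin d)}
    (h : gridIndex l x = gridIndex l y) {t : ℝ} (ht : t ∈ Set.Icc (0 : ℝ) 1) :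
    gridIndex l ((1 - t) • x + t • y) = gridIndex l x := by
  funext i
  have h1 := congrFun h i
  simp only [gridIndex] at h1 ⊢
  have hx := Int.floor_eq_iff.1 (rfl : ⌊x i / l⌋ = _)
  have hy := Int.floor_eq_iff.1 h1.symm
  have e : ((1 - t) • x + t • y) i / l = (1 - t) * (x i / l) + t * (y i / l) := by
    simp; ring
  rw [e, Int.floor_eq_iff]
  obtain ⟨h0, h1⟩ := ht
  constructor
  · nlinarith [mul_le_mul_of_nonneg_left hx.1 (sub_nonneg.2 h1), mul_le_mul_of_nonneg_left hy.1 h0]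
  · rcases h0.eq_or_lt with rfl | h0
    · simp
    · nlinarith [mul_le_mul_of_nonneg_left hx.2.le (sub_nonneg.2 h1), mul_lt_mul_of_pos_left hy.2 h0]

theorem volume_gridCube (hl : 0 < l) (x : EuclideanSpace ℝ (Fin d)) :
    volume (gridCube l x) = ENNReal.ofReal l ^ d := by
  have e : gridCube l x = (MeasurableEquiv.toLp 2 (Fin d → ℝ)).symm ⁻¹'
      (Set.pi Set.univ fun i => Set.Ico (⌊x i / l⌋ * l) (⌊x i / l⌋ * l + l)) := by
    ext y
    simp only [gridCube, gridIndex, Set.mem_ofPred_eq, funext_iff, Set.mem_preimage, Set.mem_pi,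
      Set.mem_univ, true_imp_iff, Set.mem_Ico]
    refine forall_congr' fun i => ?_
    rw [Int.floor_eq_iff, le_div_iff₀ hl, div_lt_iff₀ hl, add_mul, one_mul]
    rfl
  rw [e, (EuclideanSpace.volume_preserving_symm_measurableEquiv_toLp
    (Fin d)).measure_preimage_equiv, volume_pi_pi]
  simp

end GridCubes

/-! ### Averaging over grid cubes as a conditional expectation. -/

section GridAvg

variable {d : ℕ} {l : ℝ} {f g h : EuclideanSpace ℝ (Fin d) → ℝ≥0∞}

theorem side_pow_ne_zero (hl : 0 < l) : ENNReal.ofReal l ^ d ≠ 0 :=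
  pow_ne_zero _ (ENNReal.ofReal_pos.2 hl).ne'

theorem side_pow_ne_top : ENNReal.ofReal l ^ d ≠ ⊤ := ENNReal.pow_ne_top ENNReal.ofReal_ne_top

/-- The indicator function of the relation of lying in the same grid cube of side `l`. -/
noncomputable def gridKernel (l : ℝ)
    (z : EuclideanSpace ℝ (Fin d) × EuclideanSpace ℝ (Fin d)) : ℝ≥0∞ :=
  {z : EuclideanSpace ℝ (Fin d) × EuclideanSpace ℝ (Fin d) |
      gridIndex l z.1 = gridIndex l z.2}.indicator 1 z

theorem measurable_gridKernel (l : ℝ) : Measurable (gridKernel (d := d) l) :=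
  measurable_one.indicator (measurableSet_gridRel l)

theorem gridKernel_of_eq {x y : EuclideanSpace ℝ (Fin d)} (h : gridIndex l x = gridIndex l y) :
    gridKernel l (x, y) = 1 := by
  simp [gridKernel, h]

theorem gridKernel_of_ne {x y : EuclideanSpace ℝ (Fin d)} (h : gridIndex l x ≠ gridIndex l y) :
    gridKernel l (x, y) = 0 := by
  simp [gridKernel, h]

theorem gridKernel_comm (l : ℝ) (x y : EuclideanSpace ℝ (Fin d)) :
    gridKernel l (x, y) = gridKernel l (y, x) := by
  by_cases h : gridIndex l x = gridIndex l y
  · rw [gridKernel_of_eq h, gridKernel_of_eq h.symm]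
  · rw [gridKernel_of_ne h, gridKernel_of_ne (Ne.symm h)]

theorem setLIntegral_gridCube (l : ℝ) (f : EuclideanSpace ℝ (Fin d) → ℝ≥0∞)
    (x : EuclideanSpace ℝ (Fin d)) :
    ∫⁻ y in gridCube l x, f y = ∫⁻ y, gridKernel l (x, y) * f y := by
  rw [← lintegral_indicator (measurableSet_gridCube l x)]
  refine lintegral_congr fun y => ?_
  by_cases h : gridIndex l x = gridIndex l y
  · rw [gridKernel_of_eq h, Set.indicator_of_mem (show y ∈ gridCube l x from h.symm), one_mul]
  · rw [gridKernel_of_ne h, zero_mul]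
    exact Set.indicator_of_notMem (fun h' : y ∈ gridCube l x => h (Eq.symm h')) f

theorem measurable_gridAvg (hf : Measurable f) : Measurable (gridAvg l f) := by
  unfold gridAvg
  simp_rw [setLIntegral_gridCube]
  exact Measurable.const_mul (Measurable.lintegral_prod_right' (f := fun z =>
    gridKernel l z * f z.2) ((measurable_gridKernel l).mul (hf.comp measurable_snd))) _

theorem gridInvariant_gridAvg : GridInvariant l (gridAvg l f) := fun x y hxy => by
  rw [gridAvg, gridAvg, gridCube_congr hxy]

theorem GridInvariant.half (hf : GridInvariant l f) : GridInvariant (l / 2) f :=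
  fun x y hxy => hf x y (gridIndex_half hxy)

theorem GridInvariant.max (hf : GridInvariant l f) (hg : GridInvariant l g) :
    GridInvariant l (fun x => max (f x) (g x)) := fun x y hxy => by
  simp only [hf x y hxy, hg x y hxy]

theorem GridInvariant.comp (hf : GridInvariant l f) (φ : ℝ≥0∞ → ℝ≥0∞) :
    GridInvariant l (fun x => φ (f x)) := fun x y hxy => by
  simp only [hf x y hxy]

theorem gridAvg_mono (h : f ≤ g) : gridAvg l f ≤ gridAvg l g := fun x => by
  unfold gridAvg
  gcongr
  exact h _

theorem gridAvg_add (hf : Measurable f) :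
    gridAvg l (fun x => f x + g x) = fun x => gridAvg l f x + gridAvg l g x := by
  funext x
  rw [gridAvg, lintegral_add_left hf, mul_add]
  rfl

theorem gridAvg_invariant_mul (hf : GridInvariant l f) (hg : Measurable g)
    (x : EuclideanSpace ℝ (Fin d)) :
    gridAvg l (fun y => f y * g y) x = f x * gridAvg l g x := by
  have : ∫⁻ y in gridCube l x, f y * g y = ∫⁻ y in gridCube l x, f x * g y :=
    setLIntegral_congr_fun (measurableSet_gridCube l x) fun y hy => by
      simp only [hf y x hy]
  rw [gridAvg, this, lintegral_const_mul _ hg, gridAvg]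
  ring

theorem gridAvg_const (hl : 0 < l) (c : ℝ≥0∞) (x : EuclideanSpace ℝ (Fin d)) :
    gridAvg l (fun _ => c) x = c := by
  rw [gridAvg, setLIntegral_const, volume_gridCube hl, mul_comm c, ← mul_assoc,
    ENNReal.inv_mul_cancel (side_pow_ne_zero hl) side_pow_ne_top, one_mul]

theorem gridAvg_of_invariant (hl : 0 < l) (hf : GridInvariant l f) : gridAvg l f = f := by
  funext x
  simpa [gridAvg_const hl] using gridAvg_invariant_mul hf (g := fun _ => 1) measurable_const x

/-- Averaging is self-adjoint: its kernel is symmetric, so Tonelli suffices. -/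
theorem lintegral_gridAvg_mul (hf : Measurable f) (hg : Measurable g) :
    ∫⁻ x, gridAvg l f x * g x = ∫⁻ x, f x * gridAvg l g x := by
  unfold gridAvg
  simp_rw [setLIntegral_gridCube]
  have hK := measurable_gridKernel (d := d) l
  have hKf : ∀ x, Measurable fun y => gridKernel l (x, y) * f y := fun x =>
    (hK.comp measurable_prodMk_left).mul hf
  have hKg : ∀ x, Measurable fun y => gridKernel l (x, y) * g y := fun x =>
    (hK.comp measurable_prodMk_left).mul hg
  have h1 : ∀ x, (ENNReal.ofReal l ^ d)⁻¹ * (∫⁻ y, gridKernel l (x, y) * f y) * g x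
      = ∫⁻ y, (ENNReal.ofReal l ^ d)⁻¹ * gridKernel l (x, y) * f y * g x := fun x => by
    rw [← lintegral_const_mul _ (hKf x), ← lintegral_mul_const _ ((hKf x).const_mul _)]
    simp_rw [mul_assoc]
  have h2 : ∀ y, f y * ((ENNReal.ofReal l ^ d)⁻¹ * (∫⁻ x, gridKernel l (y, x) * g x))
      = ∫⁻ x, (ENNReal.ofReal l ^ d)⁻¹ * gridKernel l (x, y) * f y * g x := fun y => by
    rw [← lintegral_const_mul _ (hKg y), ← lintegral_const_mul _ ((hKg y).const_mul _)]
    refine lintegral_congr fun x => ?_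
    rw [gridKernel_comm l x y]
    ring
  simp_rw [h1, h2]
  refine lintegral_lintegral_swap ?_
  exact (((hK.const_mul _).mul (hf.comp measurable_snd)).mul
    (hg.comp measurable_fst)).aemeasurable

/-- Tower property. The coarse kernel is constant on fine cubes, so moving the fine average onto it
by self-adjointness changes nothing. -/
theorem gridAvg_gridAvg_half (hl : 0 < l) (hf : Measurable f) :
    gridAvg l (gridAvg (l / 2) f) = gridAvg l f := by
  funext x
  have hg : Measurable fun y => gridKernel l (x, y) :=
    (measurable_gridKernel l).comp measurable_prodMk_left
  have hinv : GridInvariant (l / 2) fun y => gridKernel l (x, y) := by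
    refine GridInvariant.half fun y z hyz => ?_
    by_cases h : gridIndex l x = gridIndex l y
    · rw [gridKernel_of_eq h, gridKernel_of_eq (h.trans hyz)]
    · rw [gridKernel_of_ne h, gridKernel_of_ne fun h' => h (h'.trans hyz.symm)]
  have key := lintegral_gridAvg_mul (l := l / 2) hf hg
  rw [gridAvg_of_invariant (half_pos hl) hinv] at key
  simp_rw [mul_comm _ (gridKernel l (x, _)), ← setLIntegral_gridCube] at key
  rw [gridAvg, key, gridAvg]

theorem gridAvg_half_le (hl : 0 < l) (x : EuclideanSpace ℝ (Fin d)) :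
    gridAvg (l / 2) f x ≤ 2 ^ d * gridAvg l f x := by
  have e : (ENNReal.ofReal (l / 2) ^ d)⁻¹ = 2 ^ d * (ENNReal.ofReal l ^ d)⁻¹ := by
    rw [ENNReal.ofReal_div_of_pos two_pos, ENNReal.div_eq_inv_mul, mul_pow,
      ENNReal.mul_inv (Or.inr side_pow_ne_top) (Or.inr (side_pow_ne_zero hl)),
      ← ENNReal.inv_pow, inv_inv]
    simp
  rw [gridAvg, gridAvg, e, mul_assoc]
  gcongr
  exact gridCube_half_subset x

/-- Jensen's inequality, in the form of monotonicity of `L^p` norms for the normalized volume on the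
cube. -/
theorem gridAvg_rpow_le (hl : 0 < l) (hf : Measurable f) {p q : ℝ} (hp : 0 < p) (hpq : p ≤ q)
    (x : EuclideanSpace ℝ (Fin d)) :
    gridAvg l (fun y => f y ^ p) x ≤ gridAvg l (fun y => f y ^ q) x ^ (p / q) := by
  set μ : Measure (EuclideanSpace ℝ (Fin d)) :=
    (ENNReal.ofReal l ^ d)⁻¹ • volume.restrict (gridCube l x) with hμ
  have : IsProbabilityMeasure μ := ⟨by
    simp [hμ, volume_gridCube hl,
      ENNReal.inv_mul_cancel (side_pow_ne_zero (d := d) hl) side_pow_ne_top]⟩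
  have e : ∀ r : ℝ, gridAvg l (fun y => f y ^ r) x = ∫⁻ y, f y ^ r ∂μ := fun r => by
    rw [hμ, lintegral_smul_measure]; rfl
  have key := eLpNorm'_le_eLpNorm'_of_exponent_le hp hpq μ hf.aestronglyMeasurable
  simp only [eLpNorm'_eq_lintegral_enorm, enorm_eq_self] at key
  rw [e, e, div_eq_mul_one_div, mul_comm p, ENNReal.rpow_mul]
  have := ENNReal.rpow_le_rpow key hp.le
  rwa [← ENNReal.rpow_mul, one_div_mul_cancel hp.ne', ENNReal.rpow_one] at this

end GridAvg

/-! ### Powers of the dyadic maximal function as `A₁`-type weights. -/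

section DyadicMaximal

/-- The function `t ↦ t^σ + σ/(1-σ) a t^(σ-1)` has derivative `σ t^(σ-2) (t - a)`, so its minimum is
at `t = a`. The proof replaces calculus by Bernoulli's inequality for `a / t`. -/
theorem Real.max_rpow_add_le {σ t a : ℝ} (h0 : 0 < σ) (h1 : σ < 1) (ht : 0 < t) :
    max t a ^ σ + σ / (1 - σ) * (a * max t a ^ (σ - 1)) ≤
      t ^ σ + σ / (1 - σ) * (a * t ^ (σ - 1)) := by
  rcases le_total a t with h | h
  · rw [max_eq_left h]
  · have ha : 0 < a := ht.trans_le h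
    have h1' : 0 < 1 - σ := sub_pos.2 h1
    rw [max_eq_right h, Real.rpow_sub_one ha.ne', Real.rpow_sub_one ht.ne',
      mul_div_cancel₀ _ ha.ne']
    have hb := rpow_one_add_le_one_add_mul_self (s := a / t - 1) (by
      have : 0 < a / t := by positivity
      linarith) h0.le h1.le
    rw [add_sub_cancel, Real.div_rpow ha.le ht.le, div_le_iff₀ (by positivity)] at hb
    calc a ^ σ + σ / (1 - σ) * a ^ σ = a ^ σ / (1 - σ) := by field_simp; ring
      _ ≤ (1 + σ * (a / t - 1)) * t ^ σ / (1 - σ) := by gcongr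
      _ = t ^ σ + σ / (1 - σ) * (a * (t ^ σ / t)) := by field_simp; ring

theorem ENNReal.max_rpow_add_le {σ : ℝ} {t a : ℝ≥0∞} (h0 : 0 < σ) (h1 : σ < 1)
    (ht : t ≠ 0) (ht' : t ≠ ⊤) (ha : a ≠ ⊤) :
    max t a ^ σ + ENNReal.ofReal (σ / (1 - σ)) * (a * max t a ^ (σ - 1)) ≤
      t ^ σ + ENNReal.ofReal (σ / (1 - σ)) * (a * t ^ (σ - 1)) := by
  lift t to ℝ≥0 using ht'
  lift a to ℝ≥0 using ha
  have ht0 : t ≠ 0 := by simpa using ht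
  have hm : max t a ≠ 0 := fun h => ht0 (le_antisymm (h ▸ le_max_left t a) zero_le)
  have hc : 0 ≤ σ / (1 - σ) := div_nonneg h0.le (sub_nonneg.2 h1.le)
  have key := Real.max_rpow_add_le (t := t) (a := a) h0 h1 (NNReal.coe_pos.2 (pos_iff_ne_zero.2 ht0))
  lift σ / (1 - σ) to ℝ≥0 using hc with c
  rw [ENNReal.ofReal_coe_nnreal, ← ENNReal.coe_max, ← ENNReal.coe_rpow_of_ne_zero hm,
    ← ENNReal.coe_rpow_of_ne_zero hm, ← ENNReal.coe_rpow_of_ne_zero ht0,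
    ← ENNReal.coe_rpow_of_ne_zero ht0]
  exact_mod_cast key

variable {d : ℕ} {L : ℝ} {f : EuclideanSpace ℝ (Fin d) → ℝ≥0∞} {t : ℝ≥0∞}

/-- The maximum of `t` and of the averages of `f` over the first `n` dyadic refinements of the
grid of side `L`. -/
noncomputable def dyadicMax (L : ℝ) (f : EuclideanSpace ℝ (Fin d) → ℝ≥0∞) (t : ℝ≥0∞) :
    ℕ → EuclideanSpace ℝ (Fin d) → ℝ≥0∞
  | 0 => fun _ => t
  | n + 1 => fun x => max (dyadicMax L f t n x) (gridAvg (L / 2 ^ (n + 1)) f x)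

theorem div_two_pow_succ (L : ℝ) (n : ℕ) : L / 2 ^ (n + 1) = L / 2 ^ n / 2 := by
  rw [pow_succ, div_mul_eq_div_div]

theorem measurable_dyadicMax (hf : Measurable f) (n : ℕ) : Measurable (dyadicMax L f t n) := by
  induction n with
  | zero => exact measurable_const
  | succ n ih => exact ih.max (measurable_gridAvg hf)

theorem gridInvariant_dyadicMax (n : ℕ) : GridInvariant (L / 2 ^ n) (dyadicMax L f t n) := by
  induction n with
  | zero => exact fun _ _ _ => rfl
  | succ n ih =>
    refine GridInvariant.max ?_ gridInvariant_gridAvg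
    rw [div_two_pow_succ]
    exact ih.half

theorem dyadicMax_mono (x : EuclideanSpace ℝ (Fin d)) :
    Monotone fun n => dyadicMax L f t n x :=
  monotone_nat_of_le_succ fun _ => le_max_left _ _

theorem gridAvg_le_dyadicMax (h0 : ∀ x, gridAvg L f x ≤ t) (n : ℕ)
    (x : EuclideanSpace ℝ (Fin d)) : gridAvg (L / 2 ^ n) f x ≤ dyadicMax L f t n x := by
  cases n with
  | zero => simpa [dyadicMax] using h0 x
  | succ n => exact le_max_right _ _

theorem dyadicMax_le {c : ℕ → ℝ≥0∞} (hc : Monotone c) (ht : t ≤ c 0)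
    (h : ∀ n x, gridAvg (L / 2 ^ n) f x ≤ c n) (n : ℕ) (x : EuclideanSpace ℝ (Fin d)) :
    dyadicMax L f t n x ≤ c n := by
  induction n with
  | zero => exact ht
  | succ n ih => exact max_le (ih.trans (hc n.le_succ)) (h _ x)

theorem dyadicMax_ne_zero (ht : t ≠ 0) (n : ℕ) (x : EuclideanSpace ℝ (Fin d)) :
    dyadicMax L f t n x ≠ 0 :=
  ((pos_iff_ne_zero.2 ht).trans_le (dyadicMax_mono x (Nat.zero_le n))).ne'

theorem dyadicMax_ne_top (ht : t ≠ ⊤) (ha : ∀ n x, gridAvg (L / 2 ^ n) f x ≠ ⊤) (n : ℕ)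
    (x : EuclideanSpace ℝ (Fin d)) : dyadicMax L f t n x ≠ ⊤ := by
  induction n with
  | zero => exact ht
  | succ n ih => exact (max_lt ih.lt_top (ha _ x).lt_top).ne

/-- The additional term carrying the average of `f` makes the bound reproduce itself from one
generation to the coarser one, so that the constant does not grow with `j`. -/
theorem gridAvg_dyadicMax_rpow_le_add {σ : ℝ} (h0 : 0 < σ) (h1 : σ < 1) (hL : 0 < L)
    (hf : Measurable f) (ht : t ≠ 0) (ht' : t ≠ ⊤) (ha : ∀ n x, gridAvg (L / 2 ^ n) f x ≠ ⊤)
    (j k : ℕ) (x : EuclideanSpace ℝ (Fin d)) :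
    gridAvg (L / 2 ^ k) (fun y => dyadicMax L f t (k + j) y ^ σ) x ≤
      dyadicMax L f t k x ^ σ +
        ENNReal.ofReal (σ / (1 - σ)) * (gridAvg (L / 2 ^ k) f x * dyadicMax L f t k x ^ (σ - 1)) := by
  induction j generalizing k x with
  | zero =>
    rw [add_zero, gridAvg_of_invariant (by positivity) ((gridInvariant_dyadicMax k).comp (· ^ σ))]
    exact le_self_add
  | succ j ih =>
    have hk : 0 < L / 2 ^ k := by positivity
    have hT := measurable_dyadicMax (L := L) (t := t) hf
    -- Condition on generation `k + 1`, where the induction hypothesis applies.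
    -- `ENNReal.max_rpow_add_le` then replaces the maximum up to `k + 1` by the one up to `k`, which
    -- is constant on the coarser cubes and comes out of the average.
    rw [← gridAvg_gridAvg_half hk ((hT _).pow_const σ), ← div_two_pow_succ]
    have h2 : gridAvg (L / 2 ^ (k + 1)) (fun y => dyadicMax L f t (k + (j + 1)) y ^ σ) ≤
        fun y => dyadicMax L f t k y ^ σ + (ENNReal.ofReal (σ / (1 - σ)) *
          dyadicMax L f t k y ^ (σ - 1)) * gridAvg (L / 2 ^ (k + 1)) f y := fun y => by
      have := (ih (k + 1) y).trans
        (ENNReal.max_rpow_add_le h0 h1 (dyadicMax_ne_zero ht k y) (dyadicMax_ne_top ht' ha k y) (ha (k + 1) y))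
      rw [add_right_comm, add_assoc] at this
      refine this.trans_eq ?_
      ring
    refine (gridAvg_mono h2 x).trans_eq ?_
    rw [gridAvg_add ((hT k).pow_const σ),
      gridAvg_of_invariant hk ((gridInvariant_dyadicMax k).comp (· ^ σ))]
    dsimp only
    rw [gridAvg_invariant_mul ((gridInvariant_dyadicMax k).comp
        fun z => ENNReal.ofReal (σ / (1 - σ)) * z ^ (σ - 1)) (measurable_gridAvg hf),
      div_two_pow_succ, gridAvg_gridAvg_half hk hf]
    ring

theorem gridAvg_dyadicMax_rpow_le {σ : ℝ} (h0 : 0 < σ) (h1 : σ < 1) (hL : 0 < L)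
    (hf : Measurable f) (ht : t ≠ 0) (ht' : t ≠ ⊤) (ha : ∀ n x, gridAvg (L / 2 ^ n) f x ≠ ⊤)
    (hat : ∀ x, gridAvg L f x ≤ t) {k n : ℕ} (hkn : k ≤ n) (x : EuclideanSpace ℝ (Fin d)) :
    gridAvg (L / 2 ^ k) (fun y => dyadicMax L f t n y ^ σ) x ≤
      ENNReal.ofReal (1 - σ)⁻¹ * dyadicMax L f t k x ^ σ := by
  obtain ⟨j, rfl⟩ := Nat.exists_eq_add_of_le hkn
  refine (gridAvg_dyadicMax_rpow_le_add h0 h1 hL hf ht ht' ha j k x).trans ?_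
  have h2 : gridAvg (L / 2 ^ k) f x * dyadicMax L f t k x ^ (σ - 1) ≤
      dyadicMax L f t k x ^ σ := by
    calc _ ≤ dyadicMax L f t k x * dyadicMax L f t k x ^ (σ - 1) := by
          gcongr; exact gridAvg_le_dyadicMax hat k x
      _ = dyadicMax L f t k x ^ (1 : ℝ) * dyadicMax L f t k x ^ (σ - 1) := by
          rw [ENNReal.rpow_one]
      _ = _ := by rw [← ENNReal.rpow_add _ _ (dyadicMax_ne_zero ht k x) (dyadicMax_ne_top ht' ha k x), add_sub_cancel]
  have e : ENNReal.ofReal (1 - σ)⁻¹ = 1 + ENNReal.ofReal (σ / (1 - σ)) := by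
    have : 0 < 1 - σ := sub_pos.2 h1
    rw [← ENNReal.ofReal_one, ← ENNReal.ofReal_add zero_le_one (by positivity)]
    congr 1
    field_simp
    ring
  rw [e, add_mul, one_mul]
  gcongr

end DyadicMaximal

/-! ### A weighted `L¹` Poincaré inequality on grid cubes. -/

section Poincare

theorem lintegral_comp_add_smul {d : ℕ} {F : EuclideanSpace ℝ (Fin d) → ℝ≥0∞} (hF : Measurable F)
    (a : EuclideanSpace ℝ (Fin d)) {t : ℝ} (ht : 0 < t) :
    ∫⁻ y, F (a + t • y) = (ENNReal.ofReal t ^ d)⁻¹ * ∫⁻ z, F z := by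
  have h1 : ∫⁻ z, F (a + z) ∂(Measure.map (t • ·) volume) = ∫⁻ y, F (a + t • y) :=
    lintegral_map (hF.comp (measurable_const_add a)) (measurable_const_smul t)
  rw [← h1, Measure.map_addHaar_smul _ ht.ne', lintegral_smul_measure, lintegral_add_left_eq_self,
    finrank_euclideanSpace_fin, abs_of_pos (by positivity), ENNReal.ofReal_inv_of_pos (by positivity),
    ENNReal.ofReal_pow ht.le, smul_eq_mul]

theorem enorm_sub_le_lintegral_fderiv {E : Type*} [NormedAddCommGroup E] [NormedSpace ℝ E]
    {v : E → ℝ} (hv : ContDiff ℝ 1 v) (x y : E) :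
    ‖v x - v y‖ₑ ≤ ‖x - y‖ₑ * ∫⁻ t in Set.Icc (0 : ℝ) 1, ‖fderiv ℝ v ((1 - t) • x + t • y)‖ₑ := by
  set γ : ℝ → E := fun t => (1 - t) • x + t • y with hγ
  have hγd : ContDiff ℝ 1 γ := by fun_prop
  have key := enorm_sub_le_lintegral_deriv_of_contDiffOn_Icc (f := fun t => v (γ t))
    (hv.comp hγd).contDiffOn zero_le_one
  have hd : ∀ t, deriv (fun t => v (γ t)) t = fderiv ℝ v (γ t) (y - x) := fun t => by
    have h1 : HasDerivAt γ (y - x) t := by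
      have h2 := (((hasDerivAt_const t (1 : ℝ)).sub (hasDerivAt_id t)).smul_const x).add
        ((hasDerivAt_id t).smul_const y)
      refine h2.congr_deriv ?_
      simp
      abel
    exact ((hv.differentiable one_ne_zero (γ t)).hasFDerivAt.comp_hasDerivAt t h1).deriv
  have hcont : Measurable fun t => ‖fderiv ℝ v (γ t)‖ₑ :=
    (((hv.continuous_fderiv one_ne_zero).comp hγd.continuous).enorm).measurable
  simp only [hγ, sub_zero, one_smul, zero_smul, add_zero, sub_self, zero_add] at key
  rw [← lintegral_const_mul _ hcont, ← enorm_neg, neg_sub]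
  refine key.trans (lintegral_mono fun t => ?_)
  have := hd t
  simp only [hγ] at this ⊢
  rw [this, mul_comm, ← enorm_neg (x - y), neg_sub]
  exact ContinuousLinearMap.le_opENorm _ _

variable {d : ℕ} {l : ℝ} {w h : EuclideanSpace ℝ (Fin d) → ℝ≥0∞}

theorem lintegral_gridKernel (hl : 0 < l) (x : EuclideanSpace ℝ (Fin d)) :
    ∫⁻ y, gridKernel l (x, y) = ENNReal.ofReal l ^ d := by
  have := setLIntegral_gridCube l 1 x
  simpa [volume_gridCube hl] using this.symm

/-- By convexity the point `z = (1-t)x + ty` stays in the cube of `x`, where `w` is constant.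
Substituting `z` for `y` has Jacobian factor `t^(-d) ≤ 2^d`. -/
theorem lintegral_gridKernel_lineMap_le_of_half_le (hl : 0 < l) (hw : Measurable w)
    (hwi : GridInvariant l w) (hh : Measurable h) {t : ℝ} (ht : 1 / 2 ≤ t) (ht1 : t ≤ 1) :
    ∫⁻ x, ∫⁻ y, gridKernel l (x, y) * (w x * h ((1 - t) • x + t • y)) ≤
      2 ^ d * ENNReal.ofReal l ^ d * ∫⁻ z, w z * h z := by
  have ht0 : 0 < t := by linarith
  have hK := measurable_gridKernel (d := d) l
  have hKx : ∀ x, Measurable fun y => gridKernel l (x, y) := fun x => hK.comp measurable_prodMk_left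
  have h1 : ∀ x, ∫⁻ y, gridKernel l (x, y) * (w x * h ((1 - t) • x + t • y)) ≤
      2 ^ d * ∫⁻ z, gridKernel l (x, z) * (w z * h z) := fun x => by
    calc ∫⁻ y, gridKernel l (x, y) * (w x * h ((1 - t) • x + t • y))
        ≤ ∫⁻ y, gridKernel l (x, (1 - t) • x + t • y) *
            (w ((1 - t) • x + t • y) * h ((1 - t) • x + t • y)) := by
          refine lintegral_mono fun y => ?_
          by_cases hxy : gridIndex l x = gridIndex l y
          · have := (gridIndex_lineMap hxy ⟨ht0.le, ht1⟩).symm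
            rw [gridKernel_of_eq hxy, gridKernel_of_eq this, hwi _ _ this]
          · simp [gridKernel_of_ne hxy]
      _ = (ENNReal.ofReal t ^ d)⁻¹ * ∫⁻ z, gridKernel l (x, z) * (w z * h z) :=
          lintegral_comp_add_smul ((hKx x).mul (hw.mul hh)) ((1 - t) • x) ht0
      _ ≤ _ := by
          gcongr
          rw [ENNReal.inv_pow]
          gcongr
          rw [ENNReal.inv_le_iff_inv_le, ← ENNReal.ofReal_ofNat 2,
            ← ENNReal.ofReal_inv_of_pos two_pos]
          exact ENNReal.ofReal_le_ofReal (by linarith)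
  calc _ ≤ ∫⁻ x, 2 ^ d * ∫⁻ z, gridKernel l (x, z) * (w z * h z) := lintegral_mono h1
    _ = 2 ^ d * ∫⁻ x, ∫⁻ z, gridKernel l (x, z) * (w z * h z) :=
        lintegral_const_mul _ (Measurable.lintegral_prod_right'
          (f := fun p => gridKernel l p * (w p.2 * h p.2)) (by fun_prop))
    _ = 2 ^ d * ∫⁻ z, ∫⁻ x, gridKernel l (z, x) * (w z * h z) := by
        rw [lintegral_lintegral_swap (by fun_prop)]
        simp_rw [gridKernel_comm]
    _ = 2 ^ d * ∫⁻ z, ENNReal.ofReal l ^ d * (w z * h z) := by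
        simp_rw [lintegral_mul_const _ (hKx _), lintegral_gridKernel hl]
    _ = _ := by rw [lintegral_const_mul _ (by fun_prop), mul_assoc]

theorem lintegral_gridKernel_lineMap_le (hl : 0 < l) (hw : Measurable w)
    (hwi : GridInvariant l w) (hh : Measurable h) {t : ℝ} (ht : t ∈ Set.Icc (0 : ℝ) 1) :
    ∫⁻ x, ∫⁻ y, gridKernel l (x, y) * (w x * h ((1 - t) • x + t • y)) ≤
      2 ^ d * ENNReal.ofReal l ^ d * ∫⁻ z, w z * h z := by
  rcases le_total (1 / 2) t with h1 | h1
  · exact lintegral_gridKernel_lineMap_le_of_half_le hl hw hwi hh h1 ht.2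
  · have hK := measurable_gridKernel (d := d) l
    -- For `t ≤ 1/2` the substitution would degenerate; exchanging `x` and `y` turns `t` into `1 -
    -- t`.
    rw [lintegral_lintegral_swap (by fun_prop)]
    refine le_trans (le_of_eq ?_) (lintegral_gridKernel_lineMap_le_of_half_le hl hw hwi hh
      (t := 1 - t) (by linarith) (by linarith [ht.1]))
    refine lintegral_congr fun y => lintegral_congr fun x => ?_
    by_cases hxy : gridIndex l x = gridIndex l y
    · rw [gridKernel_comm, hwi x y hxy, sub_sub_cancel, add_comm]
    · simp [gridKernel_of_ne hxy, gridKernel_of_ne (Ne.symm hxy)]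

/-- The Poincaré inequality in `L¹`, on all cubes of a grid at once. -/
theorem lintegral_mul_gridAvg_sub_le (hl : 0 < l) (hw : Measurable w)
    (hwi : GridInvariant l w) {v : EuclideanSpace ℝ (Fin d) → ℝ} (hv : ContDiff ℝ 1 v) :
    ∫⁻ x, w x * gridAvg l (fun y => ‖v x - v y‖ₑ) x ≤
      2 ^ d * ENNReal.ofReal (d * l) * ∫⁻ z, w z * ‖fderiv ℝ v z‖ₑ := by
  set h : EuclideanSpace ℝ (Fin d) → ℝ≥0∞ := fun z => ‖fderiv ℝ v z‖ₑ with hh'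
  have hh : Measurable h := ((hv.continuous_fderiv one_ne_zero).enorm).measurable
  have hK := measurable_gridKernel (d := d) l
  have hvc : Measurable v := hv.continuous.measurable
  have hpt : ∀ x y, gridKernel l (x, y) * ‖v x - v y‖ₑ ≤ ENNReal.ofReal (d * l) *
      ∫⁻ t in Set.Icc (0 : ℝ) 1, gridKernel l (x, y) * h ((1 - t) • x + t • y) := fun x y => by
    by_cases hxy : gridIndex l x = gridIndex l y
    · simp_rw [gridKernel_of_eq hxy, one_mul]
      refine (enorm_sub_le_lintegral_fderiv hv x y).trans ?_
      gcongr
      rw [← ofReal_norm]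
      exact ENNReal.ofReal_le_ofReal (norm_sub_le_of_gridIndex_eq hl hxy)
    · simp [gridKernel_of_ne hxy]
  set c := (ENNReal.ofReal l ^ d)⁻¹ with hc
  have hx : ∀ x, w x * gridAvg l (fun y => ‖v x - v y‖ₑ) x ≤
      c * ENNReal.ofReal (d * l) * ∫⁻ y, ∫⁻ t in Set.Icc (0 : ℝ) 1,
        gridKernel l (x, y) * (w x * h ((1 - t) • x + t • y)) := fun x => by
    have e : ∀ y, ∫⁻ t in Set.Icc (0 : ℝ) 1,
        gridKernel l (x, y) * (w x * h ((1 - t) • x + t • y)) = w x * ∫⁻ t in Set.Icc (0 : ℝ) 1,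
        gridKernel l (x, y) * h ((1 - t) • x + t • y) := fun y => by
      rw [← lintegral_const_mul _ (by fun_prop)]
      refine lintegral_congr fun t => ?_
      ring
    have hm : Measurable fun y => ∫⁻ t in Set.Icc (0 : ℝ) 1,
        gridKernel l (x, y) * h ((1 - t) • x + t • y) :=
      Measurable.lintegral_prod_right' (f := fun p : EuclideanSpace ℝ (Fin d) × ℝ =>
        gridKernel l (x, p.1) * h ((1 - p.2) • x + p.2 • p.1)) (by fun_prop)
    simp_rw [e]
    rw [lintegral_const_mul _ hm, gridAvg, setLIntegral_gridCube]
    calc _ ≤ w x * (c * ∫⁻ y, ENNReal.ofReal (d * l) *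
          ∫⁻ t in Set.Icc (0 : ℝ) 1, gridKernel l (x, y) * h ((1 - t) • x + t • y)) :=
          mul_le_mul' le_rfl (mul_le_mul' le_rfl (lintegral_mono fun y => hpt x y))
      _ = _ := by rw [lintegral_const_mul _ hm]; ring
  calc _ ≤ ∫⁻ x, c * ENNReal.ofReal (d * l) * ∫⁻ y, ∫⁻ t in Set.Icc (0 : ℝ) 1,
        gridKernel l (x, y) * (w x * h ((1 - t) • x + t • y)) := lintegral_mono hx
    _ = c * ENNReal.ofReal (d * l) * ∫⁻ x, ∫⁻ y, ∫⁻ t in Set.Icc (0 : ℝ) 1,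
        gridKernel l (x, y) * (w x * h ((1 - t) • x + t • y)) := by
        refine lintegral_const_mul _ ?_
        refine Measurable.lintegral_prod_right' (f := fun p : EuclideanSpace ℝ (Fin d) ×
          EuclideanSpace ℝ (Fin d) => ∫⁻ t in Set.Icc (0 : ℝ) 1,
          gridKernel l p * (w p.1 * h ((1 - t) • p.1 + t • p.2))) ?_
        exact Measurable.lintegral_prod_right' (f := fun q : (EuclideanSpace ℝ (Fin d) ×
          EuclideanSpace ℝ (Fin d)) × ℝ =>
          gridKernel l q.1 * (w q.1.1 * h ((1 - q.2) • q.1.1 + q.2 • q.1.2))) (by fun_prop)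
    -- The segment parameter is moved outside because the change-of-variables bound is uniform in
    -- it.
    _ = c * ENNReal.ofReal (d * l) * ∫⁻ t in Set.Icc (0 : ℝ) 1, ∫⁻ x, ∫⁻ y,
        gridKernel l (x, y) * (w x * h ((1 - t) • x + t • y)) := by
        congr 1
        have e : ∀ x, ∫⁻ y, ∫⁻ t in Set.Icc (0 : ℝ) 1,
            gridKernel l (x, y) * (w x * h ((1 - t) • x + t • y)) =
            ∫⁻ t in Set.Icc (0 : ℝ) 1, ∫⁻ y,
              gridKernel l (x, y) * (w x * h ((1 - t) • x + t • y)) := fun x =>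
          lintegral_lintegral_swap (by fun_prop)
        simp_rw [e]
        refine lintegral_lintegral_swap (Measurable.aemeasurable ?_)
        exact Measurable.lintegral_prod_right' (f := fun q : (EuclideanSpace ℝ (Fin d) × ℝ) ×
          EuclideanSpace ℝ (Fin d) =>
          gridKernel l (q.1.1, q.2) * (w q.1.1 * h ((1 - q.1.2) • q.1.1 + q.1.2 • q.2)))
          (by fun_prop)
    _ ≤ c * ENNReal.ofReal (d * l) * ∫⁻ _t in Set.Icc (0 : ℝ) 1,
        2 ^ d * ENNReal.ofReal l ^ d * ∫⁻ z, w z * h z := by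
        gcongr 1
        exact setLIntegral_mono' measurableSet_Icc fun t ht =>
          lintegral_gridKernel_lineMap_le hl hw hwi hh ht
    _ = (c * ENNReal.ofReal l ^ d) * (2 ^ d * ENNReal.ofReal (d * l) * ∫⁻ z, w z * h z) := by
        rw [setLIntegral_const]
        simp
        ring
    _ = _ := by rw [hc, ENNReal.inv_mul_cancel (side_pow_ne_zero hl) side_pow_ne_top, one_mul]

end Poincare

/-! ### Truncated geometric series. -/

section GeometricSums

theorem sum_range_pow_ite_le_of_one_lt {q : ℝ} (hq : 1 < q) {X : ℝ} (hX : 0 ≤ X) (n : ℕ) :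
    ∑ k ∈ Finset.range n, (if q ^ k ≤ X then q ^ k else 0) ≤ q / (q - 1) * X := by
  have hq' : 0 < q - 1 := sub_pos.2 hq
  have hq0 : 0 < q := by linarith
  induction n with
  | zero => simp; positivity
  | succ n ih =>
    by_cases h : q ^ n ≤ X
    · calc _ ≤ ∑ k ∈ Finset.range (n + 1), q ^ k := by
            refine Finset.sum_le_sum fun k _ => ?_
            split_ifs
            · exact le_rfl
            · positivity
        _ = (q ^ (n + 1) - 1) / (q - 1) := geom_sum_eq hq.ne' _
        _ ≤ q * q ^ n / (q - 1) := by
            rw [pow_succ']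
            gcongr
            linarith
        _ ≤ q * X / (q - 1) := by gcongr
        _ = _ := by ring
    · rw [Finset.sum_range_succ, if_neg h, add_zero]
      exact ih

theorem sum_range_half_pow_ite_le {X : ℝ} (hX : 0 ≤ X) (n : ℕ) :
    ∑ k ∈ Finset.range n, (if (1 / 2 : ℝ) ^ k ≤ X then (1 / 2 : ℝ) ^ k else 0) ≤ 2 * X := by
  induction n generalizing X with
  | zero => simpa using hX
  | succ n ih =>
    by_cases h : 1 ≤ X
    · calc _ ≤ ∑ k ∈ Finset.range (n + 1), (1 / 2 : ℝ) ^ k := by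
            refine Finset.sum_le_sum fun k _ => ?_
            split_ifs
            · exact le_rfl
            · positivity
        _ ≤ 2 := sum_geometric_two_le _
        _ ≤ 2 * X := by linarith
    · rw [Finset.sum_range_succ', pow_zero, if_neg h, add_zero]
      -- Shifting the index by one halves each term and doubles the threshold.
      have := ih (X := 2 * X) (by linarith)
      calc _ = ∑ k ∈ Finset.range n,
            1 / 2 * (if (1 / 2 : ℝ) ^ k ≤ 2 * X then (1 / 2 : ℝ) ^ k else 0) := by
            refine Finset.sum_congr rfl fun k _ => ?_
            have : (1 / 2 : ℝ) ^ (k + 1) ≤ X ↔ (1 / 2 : ℝ) ^ k ≤ 2 * X := by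
              rw [pow_succ]
              constructor <;> intro <;> linarith
            simp only [this, mul_ite, mul_zero]
            rw [pow_succ']
        _ ≤ 2 * X := by
            rw [← Finset.mul_sum]
            linarith

/-- Split at `2^k = X`: below it the terms `2^(k(p-1))` grow geometrically, above it `X^p 2^(-k)`
decays, and both parts are comparable to `X^(p-1)`. -/
theorem sum_half_pow_mul_min_rpow_le {p : ℝ} (hp : 1 < p) {X : ℝ} (hX : 0 < X) (n : ℕ) :
    ∑ k ∈ Finset.range n, (1 / 2 : ℝ) ^ k * min X (2 ^ k) ^ p ≤
      (2 ^ (p - 1) / (2 ^ (p - 1) - 1) + 2) * X ^ (p - 1) := by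
  have hq : (1 : ℝ) < 2 ^ (p - 1) := Real.one_lt_rpow (by norm_num) (by linarith)
  have hXp : X ^ p = X ^ (p - 1) * X := by
    rw [← Real.rpow_add_one hX.ne', sub_add_cancel]
  have hterm : ∀ k ∈ Finset.range n, (1 / 2 : ℝ) ^ k * min X (2 ^ k) ^ p ≤
      (if ((2 : ℝ) ^ (p - 1)) ^ k ≤ X ^ (p - 1) then ((2 : ℝ) ^ (p - 1)) ^ k else 0) +
      X ^ p * (if (1 / 2 : ℝ) ^ k ≤ 1 / X then (1 / 2 : ℝ) ^ k else 0) := fun k _ => by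
    have e : ((2 : ℝ) ^ (p - 1)) ^ k = ((2 : ℝ) ^ k) ^ (p - 1) := by
      rw [← Real.rpow_natCast, ← Real.rpow_natCast, ← Real.rpow_mul two_pos.le,
        ← Real.rpow_mul two_pos.le, mul_comm]
    have h2 : (0 : ℝ) < 2 ^ k := by positivity
    have hXp0 : 0 ≤ X ^ p := by positivity
    rcases le_total X (2 ^ k) with h | h
    · have h1 : (1 / 2 : ℝ) ^ k ≤ 1 / X := by
        rw [one_div_pow]
        exact one_div_le_one_div_of_le hX h
      rw [min_eq_left h, if_pos h1, mul_comm]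
      refine le_add_of_nonneg_left ?_
      split_ifs <;> positivity
    · have h1 : ((2 : ℝ) ^ (p - 1)) ^ k ≤ X ^ (p - 1) := by
        rw [e]
        exact Real.rpow_le_rpow h2.le h (by linarith)
      rw [min_eq_right h, if_pos h1]
      refine (le_of_eq ?_).trans (le_add_of_nonneg_right (mul_nonneg hXp0 ?_))
      · rw [e, Real.rpow_sub_one h2.ne', one_div_pow]
        ring
      · split_ifs <;> positivity
  refine (Finset.sum_le_sum hterm).trans ?_
  rw [Finset.sum_add_distrib, ← Finset.mul_sum]
  calc _ ≤ 2 ^ (p - 1) / (2 ^ (p - 1) - 1) * X ^ (p - 1) + X ^ p * (2 * (1 / X)) := by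
        gcongr
        · exact sum_range_pow_ite_le_of_one_lt hq (by positivity) n
        · exact sum_range_half_pow_ite_le (by positivity) n
    _ = _ := by
        rw [hXp]
        field_simp

theorem ENNReal.sum_half_pow_mul_min_le {p : ℝ} (hp : 1 < p) {M : ℝ} (hM : 0 < M) {w : ℝ≥0∞}
    (hw : w ≠ 0) (hw' : w ≠ ⊤) (n : ℕ) :
    ∑ k ∈ Finset.range n, ENNReal.ofReal ((1 / 2) ^ k) *
        min w (ENNReal.ofReal ((M * 2 ^ k) ^ p)) ≤
      ENNReal.ofReal ((2 ^ (p - 1) / (2 ^ (p - 1) - 1) + 2) * M) * w ^ ((p - 1) / p) := by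
  have hp0 : 0 < p := by linarith
  have hw0 : 0 < w.toReal := ENNReal.toReal_pos hw hw'
  obtain ⟨X, hX, hXw⟩ : ∃ X : ℝ, 0 < X ∧ w = ENNReal.ofReal ((M * X) ^ p) := by
    refine ⟨w.toReal ^ (1 / p) / M, by positivity, ?_⟩
    rw [mul_div_cancel₀ _ hM.ne', ← Real.rpow_mul hw0.le, one_div_mul_cancel hp0.ne',
      Real.rpow_one, ENNReal.ofReal_toReal hw']
  have hq : (1 : ℝ) < 2 ^ (p - 1) := Real.one_lt_rpow (by norm_num) (by linarith)
  have hq' : (0 : ℝ) < 2 ^ (p - 1) - 1 := sub_pos.2 hq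
  have hpow : w ^ ((p - 1) / p) = ENNReal.ofReal ((M * X) ^ (p - 1)) := by
    rw [hXw, ENNReal.ofReal_rpow_of_pos (by positivity), ← Real.rpow_mul (by positivity),
      mul_div_cancel₀ _ hp0.ne']
  have hterm : ∀ k ∈ Finset.range n, ENNReal.ofReal ((1 / 2) ^ k) *
      min w (ENNReal.ofReal ((M * 2 ^ k) ^ p)) =
      ENNReal.ofReal (M ^ p * ((1 / 2) ^ k * min X (2 ^ k) ^ p)) := fun k _ => by
    have h1 : min ((M * X) ^ p) ((M * 2 ^ k) ^ p) = M ^ p * min X (2 ^ k) ^ p := by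
      have hmono : ∀ {a b : ℝ}, 0 < a → a ≤ b → (M * a) ^ p ≤ (M * b) ^ p := fun ha hab =>
        Real.rpow_le_rpow (by positivity) (by gcongr) hp0.le
      rcases le_total X (2 ^ k) with h | h
      · rw [min_eq_left h, min_eq_left (hmono hX h), Real.mul_rpow hM.le hX.le]
      · rw [min_eq_right h, min_eq_right (hmono (by positivity) h),
          Real.mul_rpow hM.le (by positivity)]
    rw [hXw, ← ENNReal.ofReal_min, h1, ← ENNReal.ofReal_mul (by positivity)]
    ring_nf
  rw [Finset.sum_congr rfl hterm, ← ENNReal.ofReal_sum_of_nonneg fun k _ => by positivity,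
    hpow, ← ENNReal.ofReal_mul (by positivity), ← Finset.mul_sum]
  refine ENNReal.ofReal_le_ofReal ?_
  calc _ ≤ M ^ p * ((2 ^ (p - 1) / (2 ^ (p - 1) - 1) + 2) * X ^ (p - 1)) := by
        gcongr
        exact sum_half_pow_mul_min_rpow_le hp hX n
    _ = _ := by
        rw [Real.mul_rpow hM.le hX.le, Real.rpow_sub_one hM.ne' p]
        field_simp

end GeometricSums

/-! ### Passing between generations, and the limit of fine averages. -/

section Telescoping

variable {d : ℕ} {l : ℝ}

theorem enorm_le_gridAvg_add (hl : 0 < l) {v : EuclideanSpace ℝ (Fin d) → ℝ} (hv : Measurable v)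
    (x : EuclideanSpace ℝ (Fin d)) :
    ‖v x‖ₑ ≤ gridAvg l (fun y => ‖v y‖ₑ) x + gridAvg l (fun y => ‖v x - v y‖ₑ) x := by
  have h := congrFun (gridAvg_add (l := l) (f := fun y => ‖v y‖ₑ)
    (g := fun y => ‖v x - v y‖ₑ) hv.enorm) x
  rw [← h]
  refine (gridAvg_const hl ‖v x‖ₑ x).symm.le.trans (gridAvg_mono (fun y => ?_) x)
  calc ‖v x‖ₑ = ‖v y + (v x - v y)‖ₑ := by rw [add_sub_cancel]
    _ ≤ _ := enorm_add_le _ _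

/-- Bound `|v|` by its coarse average plus the mean oscillation. Self-adjointness and the tower
property turn the first part into the coarse average of `W` against `|v|`; Poincaré bounds the
second, once the fine average of `W` is dominated by `2^d` times the coarse one. -/
theorem lintegral_gridAvg_half_mul_le (hl : 0 < l) {W : EuclideanSpace ℝ (Fin d) → ℝ≥0∞}
    (hW : Measurable W) {v : EuclideanSpace ℝ (Fin d) → ℝ} (hv : ContDiff ℝ 1 v) :
    ∫⁻ x, gridAvg (l / 2) W x * ‖v x‖ₑ ≤ (∫⁻ x, gridAvg l W x * ‖v x‖ₑ) +
      2 ^ d * (2 ^ d * ENNReal.ofReal (d * l)) * ∫⁻ x, gridAvg l W x * ‖fderiv ℝ v x‖ₑ := by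
  have hvm : Measurable v := hv.continuous.measurable
  calc ∫⁻ x, gridAvg (l / 2) W x * ‖v x‖ₑ
      ≤ ∫⁻ x, (gridAvg (l / 2) W x * gridAvg l (fun y => ‖v y‖ₑ) x +
          2 ^ d * (gridAvg l W x * gridAvg l (fun y => ‖v x - v y‖ₑ) x)) := by
        refine lintegral_mono fun x => ?_
        refine (mul_le_mul' le_rfl (enorm_le_gridAvg_add hl hvm x)).trans ?_
        rw [mul_add, ← mul_assoc (2 ^ d)]
        gcongr
        exact gridAvg_half_le hl x
    _ = (∫⁻ x, gridAvg l W x * ‖v x‖ₑ) +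
          2 ^ d * ∫⁻ x, gridAvg l W x * gridAvg l (fun y => ‖v x - v y‖ₑ) x := by
        have hm : Measurable fun x => gridAvg (l / 2) W x * gridAvg l (fun y => ‖v y‖ₑ) x :=
          (measurable_gridAvg hW).mul (measurable_gridAvg hvm.enorm)
        rw [lintegral_add_left hm,
          ← lintegral_gridAvg_mul (measurable_gridAvg hW) hvm.enorm, gridAvg_gridAvg_half hl hW,
          lintegral_const_mul' _ _ (by simp)]
    _ ≤ _ := by
        rw [mul_assoc (2 ^ d)]
        gcongr
        exact lintegral_mul_gridAvg_sub_le hl (measurable_gridAvg hW) gridInvariant_gridAvg hv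

theorem lintegral_gridAvg_mul_le_sum {L : ℝ} (hL : 0 < L) {W : EuclideanSpace ℝ (Fin d) → ℝ≥0∞}
    (hW : Measurable W) {v : EuclideanSpace ℝ (Fin d) → ℝ} (hv : ContDiff ℝ 1 v) (n : ℕ) :
    ∫⁻ x, gridAvg (L / 2 ^ n) W x * ‖v x‖ₑ ≤ (∫⁻ x, gridAvg L W x * ‖v x‖ₑ) +
      4 ^ d * d * ENNReal.ofReal L * ∫⁻ x, (∑ k ∈ Finset.range n,
        ENNReal.ofReal ((1 / 2) ^ k) * gridAvg (L / 2 ^ k) W x) * ‖fderiv ℝ v x‖ₑ := by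
  have hD : Measurable fun x => ‖fderiv ℝ v x‖ₑ :=
    ((hv.continuous_fderiv one_ne_zero).enorm).measurable
  have hA : ∀ k, Measurable (gridAvg (L / 2 ^ k) W) := fun k => measurable_gridAvg hW
  induction n with
  | zero => simp
  | succ n ih =>
    have hLn : 0 < L / 2 ^ n := by positivity
    rw [div_two_pow_succ]
    refine (lintegral_gridAvg_half_mul_le hLn hW hv).trans ?_
    refine (add_le_add_left ih _).trans_eq ?_
    have e1 : ENNReal.ofReal (d * (L / 2 ^ n)) =
        d * ENNReal.ofReal L * ENNReal.ofReal ((1 / 2) ^ n) := by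
      rw [← ENNReal.ofReal_natCast, ← ENNReal.ofReal_mul (by positivity),
        ← ENNReal.ofReal_mul (by positivity)]
      congr 1
      rw [one_div_pow]
      ring
    have e2 : (4 : ℝ≥0∞) ^ d = 2 ^ d * 2 ^ d := by rw [← mul_pow]; norm_num
    simp_rw [Finset.sum_range_succ, add_mul]
    rw [lintegral_add_left (by fun_prop), e1, e2]
    simp_rw [mul_assoc (ENNReal.ofReal ((1 / 2) ^ n))]
    rw [lintegral_const_mul _ (by fun_prop)]
    ring

theorem enorm_le_liminf_gridAvg {L : ℝ} (hL : 0 < L) {v : EuclideanSpace ℝ (Fin d) → ℝ}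
    (hv : Continuous v) (x : EuclideanSpace ℝ (Fin d)) :
    ‖v x‖ₑ ≤ Filter.liminf (fun n : ℕ => gridAvg (L / 2 ^ n) (fun y => ‖v y‖ₑ) x) Filter.atTop := by
  refine le_of_forall_lt fun c hc => ?_
  obtain ⟨c', hcc', hc'⟩ := exists_between hc
  refine hcc'.trans_le (Filter.le_liminf_of_le (by isBoundedDefault) ?_)
  have hmem : {y | c' < ‖v y‖ₑ} ∈ nhds x := (isOpen_lt continuous_const hv.enorm).mem_nhds hc'
  obtain ⟨ε, hε, hball⟩ := Metric.mem_nhds_iff.1 hmem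
  have hlim : Filter.Tendsto (fun n : ℕ => d * (L / 2 ^ n)) Filter.atTop (nhds 0) := by
    have := (tendsto_pow_atTop_nhds_zero_of_lt_one (r := (1 / 2 : ℝ)) (by norm_num)
      (by norm_num)).const_mul (d * L)
    rw [mul_zero] at this
    refine this.congr fun n => ?_
    rw [one_div_pow]
    ring
  filter_upwards [hlim.eventually (gt_mem_nhds hε)] with n hn
  have hLn : 0 < L / 2 ^ n := by positivity
  refine (gridAvg_const hLn c' x).symm.le.trans ?_
  unfold gridAvg
  gcongr 1
  refine setLIntegral_mono' (measurableSet_gridCube _ x) fun y hy => ?_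
  have : y ∈ Metric.ball x ε := by
    rw [Metric.mem_ball, dist_eq_norm]
    exact (norm_sub_le_of_gridIndex_eq hLn hy).trans_lt hn
  exact (hball this).le

end Telescoping

/-! ### The weighted inequality for `W`, then for the original weight. -/

section TraceInequality

variable {d : ℕ}

/-- The inequality for the dyadic majorant `W` of the weight, with the power of `u` still bundled
with its derivative. -/
theorem lintegral_dyadicMax_mul_le {p q : ℝ} (hp : 1 < p) (hpq : p < q) {L M : ℝ} (hL : 0 < L)
    (hM : 0 < M) {f : EuclideanSpace ℝ (Fin d) → ℝ≥0∞} (hf : Measurable f)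
    (hfM : ∀ k x, gridAvg (L / 2 ^ k) f x ≤ ENNReal.ofReal ((M * 2 ^ k) ^ q))
    {v : EuclideanSpace ℝ (Fin d) → ℝ} (hv : ContDiff ℝ 1 v) (n : ℕ) :
    ∫⁻ x, dyadicMax L f (ENNReal.ofReal (M ^ q)) n x ^ (p / q) * ‖v x‖ₑ ≤
      ENNReal.ofReal (1 - p / q)⁻¹ * ENNReal.ofReal (M ^ p) * (∫⁻ x, ‖v x‖ₑ) +
      4 ^ d * d * ENNReal.ofReal L * (ENNReal.ofReal (1 - p / q)⁻¹ *
        ENNReal.ofReal ((2 ^ (p - 1) / (2 ^ (p - 1) - 1) + 2) * M)) *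
        ∫⁻ x, (dyadicMax L f (ENNReal.ofReal (M ^ q)) n x ^ (p / q)) ^ ((p - 1) / p) *
          ‖fderiv ℝ v x‖ₑ := by
  have hp0 : 0 < p := by linarith
  have hq0 : 0 < q := by linarith
  have hσ0 : 0 < p / q := by positivity
  have hσ1 : p / q < 1 := (div_lt_one hq0).2 hpq
  set t := ENNReal.ofReal (M ^ q) with ht
  have ht0 : t ≠ 0 := (ENNReal.ofReal_pos.2 (by positivity)).ne'
  have htt : t ≠ ⊤ := ENNReal.ofReal_ne_top
  have hfin : ∀ k x, gridAvg (L / 2 ^ k) f x ≠ ⊤ := fun k x =>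
    ((hfM k x).trans_lt ENNReal.ofReal_lt_top).ne
  have hft : ∀ x, gridAvg L f x ≤ t := fun x => by simpa using hfM 0 x
  set W : EuclideanSpace ℝ (Fin d) → ℝ≥0∞ := fun x => dyadicMax L f t n x ^ (p / q) with hW
  have hWm : Measurable W := (measurable_dyadicMax hf n).pow_const _
  set C := ENNReal.ofReal (1 - p / q)⁻¹ with hC
  have hpowq : ∀ a : ℝ, 0 < a → ENNReal.ofReal (a ^ q) ^ (p / q) = ENNReal.ofReal (a ^ p) :=
    fun a ha => by
      rw [ENNReal.ofReal_rpow_of_pos (by positivity), ← Real.rpow_mul ha.le,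
        mul_div_cancel₀ _ hq0.ne']
  have hmono : Monotone fun k : ℕ => ENNReal.ofReal ((M * 2 ^ k) ^ q) := fun a b hab => by
    refine ENNReal.ofReal_le_ofReal (Real.rpow_le_rpow (by positivity) ?_ hq0.le)
    gcongr
    exact one_le_two
  -- The maximum up to generation `k` is at most the one up to `n`, and also obeys the growth bound
  -- on averages. Keeping both is what produces the power `(p - 1) / p` of `W` after summation.
  have hE : ∀ k ≤ n, ∀ x, gridAvg (L / 2 ^ k) W x ≤
      C * min (W x) (ENNReal.ofReal ((M * 2 ^ k) ^ p)) := fun k hk x => by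
    refine (gridAvg_dyadicMax_rpow_le hσ0 hσ1 hL hf ht0 htt hfin hft hk x).trans ?_
    gcongr
    refine le_min (ENNReal.rpow_le_rpow (dyadicMax_mono x hk) hσ0.le) ?_
    rw [← hpowq _ (by positivity)]
    exact ENNReal.rpow_le_rpow (dyadicMax_le hmono (by simp [ht]) hfM k x) hσ0.le
  have hWinv : gridAvg (L / 2 ^ n) W = W :=
    gridAvg_of_invariant (by positivity) ((gridInvariant_dyadicMax n).comp (· ^ (p / q)))
  have key := lintegral_gridAvg_mul_le_sum hL hWm hv n
  rw [hWinv] at key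
  refine key.trans (add_le_add ?_ ?_)
  · rw [← lintegral_const_mul _ hv.continuous.measurable.enorm]
    refine lintegral_mono fun x => ?_
    gcongr
    have := hE 0 (Nat.zero_le n) x
    simp only [pow_zero, div_one, mul_one] at this
    exact this.trans (mul_le_mul' le_rfl (min_le_right _ _))
  · rw [mul_assoc (4 ^ d * d * ENNReal.ofReal L)]
    gcongr
    have hm : Measurable fun x => W x ^ ((p - 1) / p) * ‖fderiv ℝ v x‖ₑ :=
      (hWm.pow_const _).mul (hv.continuous_fderiv one_ne_zero).enorm.measurable
    rw [← lintegral_const_mul _ hm]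
    refine lintegral_mono fun x => ?_
    rw [← mul_assoc]
    gcongr
    have hW0 : W x ≠ 0 := (ENNReal.rpow_pos (pos_iff_ne_zero.2 (dyadicMax_ne_zero ht0 n x))
      (dyadicMax_ne_top htt hfin n x)).ne'
    have hWt : W x ≠ ⊤ := ENNReal.rpow_ne_top_of_nonneg hσ0.le (dyadicMax_ne_top htt hfin n x)
    rw [mul_assoc]
    refine le_trans ?_ (mul_le_mul' le_rfl (ENNReal.sum_half_pow_mul_min_le hp hM hW0 hWt n))
    rw [Finset.mul_sum]
    refine Finset.sum_le_sum fun k hk => ?_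
    rw [mul_left_comm]
    gcongr
    exact hE k (Finset.mem_range.1 hk).le x

theorem le_of_le_add_div_add_div {p : ℝ} (hp : 1 < p) {A B G : ℝ≥0∞} (hA : A ≠ ⊤)
    (h : A ≤ B + (A / ENNReal.ofReal (p / (p - 1)) + G / ENNReal.ofReal p)) :
    A ≤ ENNReal.ofReal p * B + G := by
  have hp0 : 0 < p := by linarith
  have hp1 : 0 < p - 1 := by linarith
  have hpne : ENNReal.ofReal p ≠ 0 := (ENNReal.ofReal_pos.2 hp0).ne'
  have hsum : A = A / ENNReal.ofReal p + A / ENNReal.ofReal (p / (p - 1)) := by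
    rw [div_eq_mul_inv, div_eq_mul_inv, ← mul_add, ← ENNReal.ofReal_inv_of_pos hp0,
      ← ENNReal.ofReal_inv_of_pos (by positivity), ← ENNReal.ofReal_add (by positivity)
        (by positivity)]
    have : p⁻¹ + (p / (p - 1))⁻¹ = 1 := by field_simp; ring
    rw [this, ENNReal.ofReal_one, mul_one]
  have hfin : A / ENNReal.ofReal (p / (p - 1)) ≠ ⊤ :=
    ENNReal.div_ne_top hA (ENNReal.ofReal_pos.2 (by positivity)).ne'
  have h2 : A / ENNReal.ofReal p ≤ B + G / ENNReal.ofReal p := by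
    refine (ENNReal.add_le_add_iff_right hfin).1 ?_
    rw [← hsum]
    refine h.trans_eq ?_
    ring
  calc A = ENNReal.ofReal p * (A / ENNReal.ofReal p) :=
        (ENNReal.mul_div_cancel hpne ENNReal.ofReal_ne_top).symm
    _ ≤ ENNReal.ofReal p * (B + G / ENNReal.ofReal p) := by gcongr
    _ = _ := by rw [mul_add, ENNReal.mul_div_cancel hpne ENNReal.ofReal_ne_top]

theorem enorm_fderiv_abs_rpow_le {E : Type*} [NormedAddCommGroup E] [NormedSpace ℝ E] {u : E → ℝ}
    (hu : Differentiable ℝ u) {p : ℝ} (hp : 1 < p) (x : E) :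
    ‖fderiv ℝ (fun x => ‖u x‖ ^ p) x‖ₑ ≤
      ENNReal.ofReal p * ‖u x‖ₑ ^ (p - 1) * ‖fderiv ℝ u x‖ₑ := by
  have h := norm_fderiv_norm_rpow_le hu (x := x) hp
  rw [← ofReal_norm, ← ofReal_norm, ← ofReal_norm (fderiv ℝ u x),
    ENNReal.ofReal_rpow_of_nonneg (norm_nonneg _) (by linarith),
    ← ENNReal.ofReal_mul (by linarith), ← ENNReal.ofReal_mul (by positivity)]
  exact ENNReal.ofReal_le_ofReal h

theorem enorm_norm_rpow {u : ℝ} {p : ℝ} (hp : 0 ≤ p) : ‖‖u‖ ^ p‖ₑ = ‖u‖ₑ ^ p := by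
  rw [Real.enorm_rpow_of_nonneg (norm_nonneg _) hp, enorm_norm]

theorem lintegral_enorm_rpow_lt_top {u : EuclideanSpace ℝ (Fin d) → ℝ} (hu : Continuous u)
    (hs : HasCompactSupport u) {p : ℝ} (hp : 0 < p) : ∫⁻ x, ‖u x‖ₑ ^ p < ⊤ := by
  have h1 : Continuous fun x => ‖u x‖ ^ p := hu.norm.rpow_const fun _ => Or.inr hp.le
  have h2 : HasCompactSupport fun x => ‖u x‖ ^ p :=
    hs.comp_left (g := fun z : ℝ => ‖z‖ ^ p) (by simp [hp.ne'])
  have h3 := (h1.integrable_of_hasCompactSupport h2 (μ := volume)).2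
  simpa only [HasFiniteIntegral, enorm_norm_rpow hp.le] using h3

theorem lintegral_dyadicMax_mul_rpow_le {p q : ℝ} (hp : 1 < p) (hpq : p < q) {L M : ℝ}
    (hL : 0 < L) (hM : 0 < M) {f : EuclideanSpace ℝ (Fin d) → ℝ≥0∞} (hf : Measurable f)
    (hfM : ∀ k x, gridAvg (L / 2 ^ k) f x ≤ ENNReal.ofReal ((M * 2 ^ k) ^ q))
    {u : EuclideanSpace ℝ (Fin d) → ℝ} (hu : ContDiff ℝ 1 u) (hs : HasCompactSupport u) (n : ℕ) :
    ∫⁻ x, dyadicMax L f (ENNReal.ofReal (M ^ q)) n x ^ (p / q) * ‖u x‖ₑ ^ p ≤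
      ENNReal.ofReal p * (ENNReal.ofReal (1 - p / q)⁻¹ * ENNReal.ofReal (M ^ p) *
        ∫⁻ x, ‖u x‖ₑ ^ p) +
      (4 ^ d * d * ENNReal.ofReal L * (ENNReal.ofReal (1 - p / q)⁻¹ *
        ENNReal.ofReal ((2 ^ (p - 1) / (2 ^ (p - 1) - 1) + 2) * M)) * ENNReal.ofReal p) ^ p *
        ∫⁻ x, ‖fderiv ℝ u x‖ₑ ^ p := by
  have hp0 : 0 < p := by linarith
  have hp1 : 0 < p - 1 := by linarith
  have hq0 : 0 < q := by linarith
  have hσ0 : 0 < p / q := by positivity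
  have key := lintegral_dyadicMax_mul_le hp hpq hL hM hf hfM (hu.norm_rpow hp) n
  simp only [enorm_norm_rpow hp0.le] at key
  set W : EuclideanSpace ℝ (Fin d) → ℝ≥0∞ :=
    fun x => dyadicMax L f (ENNReal.ofReal (M ^ q)) n x ^ (p / q) with hW
  have hWm : Measurable W := (measurable_dyadicMax hf n).pow_const _
  set C := 4 ^ d * d * ENNReal.ofReal L * (ENNReal.ofReal (1 - p / q)⁻¹ *
        ENNReal.ofReal ((2 ^ (p - 1) / (2 ^ (p - 1) - 1) + 2) * M)) with hC
  have hDm : Measurable fun x => ‖fderiv ℝ u x‖ₑ :=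
    (hu.continuous_fderiv one_ne_zero).enorm.measurable
  have hum : Measurable fun x => ‖u x‖ₑ := hu.continuous.enorm.measurable
  -- Absorption requires finiteness, which holds because stopping at generation `n` makes `W`
  -- bounded.
  have hfin : ∫⁻ x, W x * ‖u x‖ₑ ^ p ≠ ⊤ := by
    have hWle : ∀ x, W x ≤ ENNReal.ofReal ((M * 2 ^ n) ^ q) ^ (p / q) := fun x => by
      refine ENNReal.rpow_le_rpow (dyadicMax_le (c := fun k => ENNReal.ofReal ((M * 2 ^ k) ^ q))
        (fun a b hab => ?_) (by simp) hfM n x) hσ0.le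
      refine ENNReal.ofReal_le_ofReal (Real.rpow_le_rpow (by positivity) ?_ hq0.le)
      gcongr
      exact one_le_two
    refine ((lintegral_mono fun x => mul_le_mul' (hWle x) le_rfl).trans_lt ?_).ne
    rw [lintegral_const_mul _ (by fun_prop)]
    exact ENNReal.mul_lt_top (ENNReal.rpow_lt_top_of_nonneg hσ0.le ENNReal.ofReal_ne_top)
      (lintegral_enorm_rpow_lt_top hu.continuous hs hp0)
  have hyoung : C * ∫⁻ x, W x ^ ((p - 1) / p) * ‖fderiv ℝ (fun x => ‖u x‖ ^ p) x‖ₑ ≤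
      (∫⁻ x, W x * ‖u x‖ₑ ^ p) / ENNReal.ofReal (p / (p - 1)) +
        ((C * ENNReal.ofReal p) ^ p * ∫⁻ x, ‖fderiv ℝ u x‖ₑ ^ p) / ENNReal.ofReal p := by
    have hconj : (p / (p - 1)).HolderConjugate p := by
      rw [Real.holderConjugate_iff]
      refine ⟨by rw [one_lt_div hp1]; linarith, by field_simp; ring⟩
    have hm1 : Measurable fun x => W x ^ ((p - 1) / p) * ‖fderiv ℝ (fun x => ‖u x‖ ^ p) x‖ₑ := by
      have := ((hu.norm_rpow hp).continuous_fderiv one_ne_zero).enorm.measurable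
      fun_prop
    have hm2 : Measurable fun x => W x * ‖u x‖ₑ ^ p := by fun_prop
    rw [← lintegral_const_mul _ hm1]
    simp only [div_eq_mul_inv _ (ENNReal.ofReal p), div_eq_mul_inv _ (ENNReal.ofReal (p / (p - 1)))]
    rw [← lintegral_const_mul _ (by fun_prop), ← lintegral_mul_const _ hm2,
      ← lintegral_mul_const _ (by fun_prop), ← lintegral_add_left (by fun_prop)]
    refine lintegral_mono fun x => ?_
    generalize W x = w
    -- The first factor raised to `p / (p - 1)` is exactly `w |u|^p`; all constants are put with the
    -- gradient.
    have hy := ENNReal.young_inequality (w ^ ((p - 1) / p) * ‖u x‖ₑ ^ (p - 1))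
      (C * ENNReal.ofReal p * ‖fderiv ℝ u x‖ₑ) hconj
    rw [ENNReal.mul_rpow_of_nonneg _ _ (by positivity), ← ENNReal.rpow_mul, ← ENNReal.rpow_mul,
      ENNReal.mul_rpow_of_nonneg _ _ hp0.le, div_mul_div_cancel₀ hp0.ne', div_self hp1.ne',
      ENNReal.rpow_one, mul_div_cancel₀ _ hp1.ne'] at hy
    calc _ ≤ C * (w ^ ((p - 1) / p) *
          (ENNReal.ofReal p * ‖u x‖ₑ ^ (p - 1) * ‖fderiv ℝ u x‖ₑ)) := by
          gcongr
          exact enorm_fderiv_abs_rpow_le (hu.differentiable one_ne_zero) hp x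
      _ = _ := by ring
      _ ≤ _ := hy
      _ = _ := by simp only [div_eq_mul_inv]
  exact le_of_le_add_div_add_div hp hfin (key.trans (add_le_add_right hyoung _))

/-- Only the continuous factor `|u|^p` is approximated by averages, so no differentiation theorem
for `φ` is needed. -/
theorem lintegral_rpow_mul_le_of_gridAvg_le {p q : ℝ} (hp : 1 < p) (hpq : p < q) {L M : ℝ}
    (hL : 0 < L) (hM : 0 < M) {φ : EuclideanSpace ℝ (Fin d) → ℝ≥0∞} (hφ : Measurable φ)
    (hφM : ∀ k x, gridAvg (L / 2 ^ k) (fun y => φ y ^ q) x ≤ ENNReal.ofReal ((M * 2 ^ k) ^ q))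
    {u : EuclideanSpace ℝ (Fin d) → ℝ} (hu : ContDiff ℝ 1 u) (hs : HasCompactSupport u) :
    ∫⁻ x, φ x ^ p * ‖u x‖ₑ ^ p ≤
      ENNReal.ofReal p * (ENNReal.ofReal (1 - p / q)⁻¹ * ENNReal.ofReal (M ^ p) *
        ∫⁻ x, ‖u x‖ₑ ^ p) +
      (4 ^ d * d * ENNReal.ofReal L * (ENNReal.ofReal (1 - p / q)⁻¹ *
        ENNReal.ofReal ((2 ^ (p - 1) / (2 ^ (p - 1) - 1) + 2) * M)) * ENNReal.ofReal p) ^ p *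
        ∫⁻ x, ‖fderiv ℝ u x‖ₑ ^ p := by
  have hp0 : 0 < p := by linarith
  have hq0 : 0 < q := by linarith
  have hvc : Continuous fun x => ‖u x‖ ^ p := (hu.norm_rpow hp).continuous
  have hvm : Measurable fun x => ‖‖u x‖ ^ p‖ₑ := hvc.enorm.measurable
  simp_rw [← enorm_norm_rpow hp0.le]
  calc ∫⁻ x, φ x ^ p * ‖‖u x‖ ^ p‖ₑ
      ≤ ∫⁻ x, Filter.liminf (fun n : ℕ => φ x ^ p *
          gridAvg (L / 2 ^ n) (fun y => ‖‖u y‖ ^ p‖ₑ) x) Filter.atTop := by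
        refine lintegral_mono fun x => ?_
        refine le_trans ?_ (ENNReal.le_liminf_mul (u := fun _ => φ x ^ p))
        rw [Filter.liminf_const]
        gcongr
        exact enorm_le_liminf_gridAvg hL hvc x
    _ ≤ Filter.liminf (fun n : ℕ => ∫⁻ x, φ x ^ p *
          gridAvg (L / 2 ^ n) (fun y => ‖‖u y‖ ^ p‖ₑ) x) Filter.atTop :=
        lintegral_liminf_le fun n => (hφ.pow_const p).mul (measurable_gridAvg hvm)
    _ ≤ _ := by
        refine Filter.liminf_le_of_frequently_le' (Filter.Frequently.of_forall fun n => ?_)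
        rw [← lintegral_gridAvg_mul (hφ.pow_const p) hvm]
        simp_rw [enorm_norm_rpow hp0.le]
        refine le_trans (lintegral_mono fun x => ?_)
          (lintegral_dyadicMax_mul_rpow_le hp hpq hL hM (hφ.pow_const q) hφM hu hs n)
        gcongr
        refine (gridAvg_rpow_le (by positivity) hφ hp0 hpq.le x).trans ?_
        gcongr
        exact gridAvg_le_dyadicMax (fun y => by simpa using hφM 0 y) n x

end TraceInequality

/-! ### From balls to grid cubes. -/

section LocalMorrey

variable {d : ℕ}

theorem gridCube_subset_ball {l : ℝ} (hl : 0 < l) (x : EuclideanSpace ℝ (Fin d)) :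
    gridCube l x ⊆ Metric.ball x ((d + 1) * l) := fun y hy => by
  rw [Metric.mem_ball, dist_eq_norm]
  refine (norm_sub_le_of_gridIndex_eq hl hy).trans_lt ?_
  nlinarith

/-- Averages over grid cubes are controlled by averages over balls. -/
theorem gridAvg_le_avgLpNorm {F : Type*} [NormedAddCommGroup F] {q l : ℝ} (hq : 0 < q)
    (hl : 0 < l) (b : EuclideanSpace ℝ (Fin d) → F) (x : EuclideanSpace ℝ (Fin d)) :
    gridAvg l (fun y => ‖b y‖ₑ ^ q) x ≤
      (d + 1) ^ d * volume (Metric.ball (0 : EuclideanSpace ℝ (Fin d)) 1) *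
        avgLpNorm q b (Metric.ball x ((d + 1) * l)) ^ q := by
  have hρ : 0 < (d + 1) * l := by positivity
  have hvol : volume (Metric.ball x ((d + 1) * l)) =
      (ENNReal.ofReal l ^ d) * ((d + 1) ^ d *
        volume (Metric.ball (0 : EuclideanSpace ℝ (Fin d)) 1)) := by
    rw [Measure.addHaar_ball_of_pos _ _ hρ, finrank_euclideanSpace_fin, mul_pow,
      ENNReal.ofReal_mul (by positivity), ENNReal.ofReal_pow (by positivity),
      ENNReal.ofReal_pow hl.le, ENNReal.ofReal_add (by positivity) zero_le_one,
      ENNReal.ofReal_natCast, ENNReal.ofReal_one]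
    ring
  have h0 : volume (Metric.ball x ((d + 1) * l)) ≠ 0 := (Metric.measure_ball_pos _ _ hρ).ne'
  have ht : volume (Metric.ball x ((d + 1) * l)) ≠ ⊤ := measure_ball_lt_top.ne
  have havg : avgLpNorm q b (Metric.ball x ((d + 1) * l)) ^ q =
      (∫⁻ y in Metric.ball x ((d + 1) * l), ‖b y‖ₑ ^ q) /
        volume (Metric.ball x ((d + 1) * l)) := by
    rw [avgLpNorm, ← ENNReal.rpow_mul, one_div_mul_cancel hq.ne', ENNReal.rpow_one,
      setLAverage_eq]
  calc gridAvg l (fun y => ‖b y‖ₑ ^ q) x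
      ≤ (ENNReal.ofReal l ^ d)⁻¹ * ∫⁻ y in Metric.ball x ((d + 1) * l), ‖b y‖ₑ ^ q := by
        unfold gridAvg
        gcongr
        exact gridCube_subset_ball hl x
    _ = (ENNReal.ofReal l ^ d)⁻¹ * (volume (Metric.ball x ((d + 1) * l)) *
          avgLpNorm q b (Metric.ball x ((d + 1) * l)) ^ q) := by
        rw [havg, ENNReal.mul_div_cancel h0 ht]
    _ = ((ENNReal.ofReal l ^ d)⁻¹ * ENNReal.ofReal l ^ d) * _ * _ := by
        rw [hvol, ← mul_assoc, ← mul_assoc]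
    _ = _ := by rw [ENNReal.inv_mul_cancel (side_pow_ne_zero hl) side_pow_ne_top, one_mul]

theorem ofReal_mul_avgLpNorm_le_localMorrey {F : Type*} [NormedAddCommGroup F] {q ρb ρ : ℝ}
    (hρ : ρ ∈ Set.Ioc 0 ρb) (b : EuclideanSpace ℝ (Fin d) → F) (x : EuclideanSpace ℝ (Fin d)) :
    ENNReal.ofReal ρ * avgLpNorm q b (Metric.ball x ρ) ≤ localMorrey q ρb b :=
  (mul_le_mul' le_rfl (le_iSup (fun x => avgLpNorm q b (Metric.ball x ρ)) x)).trans
    (le_iSup₂ (f := fun ρ (_ : ρ ∈ Set.Ioc 0 ρb) =>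
      ENNReal.ofReal ρ * ⨆ x, avgLpNorm q b (Metric.ball x ρ)) ρ hρ)

/-- With this choice of side the enclosing balls have radius `ρb / 2^k`, hence are admissible for
every `k`. -/
theorem gridAvg_le_localMorrey {F : Type*} [NormedAddCommGroup F] {q ρb : ℝ} (hq : 0 < q)
    (hρb : 0 < ρb) (b : EuclideanSpace ℝ (Fin d) → F) (k : ℕ) (x : EuclideanSpace ℝ (Fin d)) :
    gridAvg (ρb / (d + 1) / 2 ^ k) (fun y => ‖b y‖ₑ ^ q) x ≤
      (d + 1) ^ d * volume (Metric.ball (0 : EuclideanSpace ℝ (Fin d)) 1) *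
        (localMorrey q ρb b * ENNReal.ofReal (2 ^ k / ρb)) ^ q := by
  refine (gridAvg_le_avgLpNorm hq (by positivity) b x).trans ?_
  gcongr
  have e : (d + 1) * (ρb / (d + 1) / 2 ^ k) = ρb / 2 ^ k := by field_simp
  have hρ : 0 < ρb / 2 ^ k := by positivity
  rw [e, ← inv_div ρb, ENNReal.ofReal_inv_of_pos hρ, ← div_eq_mul_inv, ENNReal.le_div_iff_mul_le
    (Or.inl (ENNReal.ofReal_pos.2 hρ).ne') (Or.inl ENNReal.ofReal_ne_top), mul_comm]
  exact ofReal_mul_avgLpNorm_le_localMorrey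
    ⟨hρ, div_le_self hρb.le (one_le_pow₀ one_le_two)⟩ b x

theorem lintegral_gridAvg {l : ℝ} (hl : 0 < l) {f : EuclideanSpace ℝ (Fin d) → ℝ≥0∞}
    (hf : Measurable f) : ∫⁻ x, gridAvg l f x = ∫⁻ x, f x := by
  have := lintegral_gridAvg_mul (l := l) (g := fun _ => 1) hf measurable_const
  simpa [gridAvg_const hl] using this

theorem enorm_gradient {u : EuclideanSpace ℝ (Fin d) → ℝ} (x : EuclideanSpace ℝ (Fin d)) :
    ‖gradient u x‖ₑ = ‖fderiv ℝ u x‖ₑ := by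
  rw [← ofReal_norm, ← ofReal_norm, gradient, LinearIsometryEquiv.norm_map]

end LocalMorrey

/-! ### Assembly and tracking of constants. -/

theorem lemma2p8 (d : ℕ) (hd : 2 ≤ d) (p pb : ℝ) (hp : 1 < p) (hpb : p < pb) :
    ∃ N : ℝ≥0, ∀ ρb : ℝ, 0 < ρb →
      ∀ (F : Type*) [NormedAddCommGroup F] (b : EuclideanSpace ℝ (Fin d) → F),
        AEStronglyMeasurable b volume → localMorrey pb ρb b < (⊤ : ℝ≥0∞) →
      ∀ u : EuclideanSpace ℝ (Fin d) → ℝ, ContDiff ℝ ∞ u → HasCompactSupport u →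
        ∫⁻ x, ‖b x‖ₑ ^ p * ‖u x‖ₑ ^ p ≤
          (N : ℝ≥0∞) * localMorrey pb ρb b ^ p * (∫⁻ x, ‖gradient u x‖ₑ ^ p) +
          (N : ℝ≥0∞) * ENNReal.ofReal (ρb ^ (-p)) * localMorrey pb ρb b ^ p *
            (∫⁻ x, ‖u x‖ₑ ^ p) := by
  have hp0 : 0 < p := by linarith
  have hq0 : 0 < pb := by linarith
  have hq : (1 : ℝ) < 2 ^ (p - 1) := Real.one_lt_rpow (by norm_num) (by linarith)
  have hq' : (0 : ℝ) < 2 ^ (p - 1) - 1 := sub_pos.2 hq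
  set Θ : ℝ≥0∞ := (d + 1) ^ d * volume (Metric.ball (0 : EuclideanSpace ℝ (Fin d)) 1) with hΘ
  have hΘt : Θ ≠ ⊤ := ENNReal.mul_ne_top (by simp) measure_ball_lt_top.ne
  have hΘ0 : Θ ≠ 0 := mul_ne_zero (by positivity) (Metric.measure_ball_pos _ _ one_pos).ne'
  -- The ball-to-cube factor is written as a `pb`-th power so that it merges into `M`.
  set θ : ℝ := Θ.toReal ^ (1 / pb) with hθ
  have hθ0 : 0 < θ := Real.rpow_pos_of_pos (ENNReal.toReal_pos hΘ0 hΘt) _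
  have hθq : ENNReal.ofReal (θ ^ pb) = Θ := by
    rw [hθ, ← Real.rpow_mul ENNReal.toReal_nonneg, one_div_mul_cancel hq0.ne', Real.rpow_one,
      ENNReal.ofReal_toReal hΘt]
  set C₀ := ENNReal.ofReal (1 - p / pb)⁻¹
  set C₁ : ℝ := 2 ^ (p - 1) / (2 ^ (p - 1) - 1) + 2
  have hC₁ : 0 < C₁ := by positivity
  set N₁ : ℝ≥0∞ := ENNReal.ofReal p * (C₀ * ENNReal.ofReal (θ ^ p)) with hN₁
  set N₂ : ℝ≥0∞ := (4 ^ d * d * C₀ * ENNReal.ofReal (C₁ * θ) * ENNReal.ofReal p) ^ p with hN₂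
  have hN₁t : N₁ ≠ ⊤ := by finiteness
  have hN₂t : N₂ ≠ ⊤ := ENNReal.rpow_ne_top_of_nonneg hp0.le (by finiteness)
  refine ⟨(N₁ + N₂).toNNReal, fun ρb hρb F _ b hb hK u hu hs => ?_⟩
  rw [ENNReal.coe_toNNReal (ENNReal.add_ne_top.2 ⟨hN₁t, hN₂t⟩)]
  set K := localMorrey pb ρb b with hKdef
  have hL : 0 < ρb / (d + 1) := by positivity
  obtain ⟨φ, hφ, hbφ⟩ : ∃ φ : EuclideanSpace ℝ (Fin d) → ℝ≥0∞, Measurable φ ∧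
      (fun x => ‖b x‖ₑ) =ᵐ[volume] φ := ⟨_, hb.enorm.measurable_mk, hb.enorm.ae_eq_mk⟩
  have hav : ∀ (k : ℕ) (x : EuclideanSpace ℝ (Fin d)),
      gridAvg (ρb / (d + 1) / 2 ^ k) (fun y => φ y ^ pb) x ≤
        Θ * (K * ENNReal.ofReal (2 ^ k / ρb)) ^ pb := fun k x => by
    refine le_trans (le_of_eq ?_) (gridAvg_le_localMorrey hq0 hρb b k x)
    unfold gridAvg
    congr 1
    refine lintegral_congr_ae (ae_restrict_of_ae ?_)
    filter_upwards [hbφ] with y hy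
    rw [← hy]
  have hint : ∫⁻ x, ‖b x‖ₑ ^ p * ‖u x‖ₑ ^ p = ∫⁻ x, φ x ^ p * ‖u x‖ₑ ^ p := by
    refine lintegral_congr_ae ?_
    filter_upwards [hbφ] with y hy
    rw [← hy]
  rw [hint]
  -- The maximal function argument requires `M > 0`; if `K = 0`, then `b` vanishes almost
  -- everywhere.
  rcases eq_or_ne K 0 with hK0 | hK0
  · have hz : ∫⁻ x, φ x ^ pb = 0 := by
      rw [← lintegral_gridAvg hL (hφ.pow_const pb)]
      refine (lintegral_congr fun x => ?_).trans lintegral_zero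
      have := hav 0 x
      rw [hK0, zero_mul, ENNReal.zero_rpow_of_pos hq0, mul_zero] at this
      simpa using this
    rw [lintegral_eq_zero_iff (hφ.pow_const pb)] at hz
    have : ∫⁻ x, φ x ^ p * ‖u x‖ₑ ^ p = 0 := by
      refine (lintegral_congr_ae ?_).trans lintegral_zero
      filter_upwards [hz] with x hx
      have hx0 : φ x = 0 := (ENNReal.rpow_eq_zero_iff_of_pos hq0).1 hx
      rw [hx0, ENNReal.zero_rpow_of_pos hp0, zero_mul]
    rw [this]
    exact zero_le
  have hκ : 0 < K.toReal := ENNReal.toReal_pos hK0 hK.ne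
  set κ := K.toReal
  have hKκ : K = ENNReal.ofReal κ := (ENNReal.ofReal_toReal hK.ne).symm
  set M := θ * κ / ρb with hMdef
  have hM : 0 < M := by positivity
  have hφM : ∀ (k : ℕ) (x : EuclideanSpace ℝ (Fin d)),
      gridAvg (ρb / (d + 1) / 2 ^ k) (fun y => φ y ^ pb) x ≤
        ENNReal.ofReal ((M * 2 ^ k) ^ pb) := fun k x => by
    refine (hav k x).trans_eq ?_
    rw [← hθq, hKκ, ← ENNReal.ofReal_mul hκ.le, ENNReal.ofReal_rpow_of_pos (by positivity),
      ← ENNReal.ofReal_mul (by positivity), ← Real.mul_rpow hθ0.le (by positivity)]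
    congr 2
    rw [hMdef]
    ring
  refine (lintegral_rpow_mul_le_of_gridAvg_le hp hpb hL hM hφ hφM
    (hu.of_le (by exact_mod_cast le_top)) hs).trans ?_
  simp_rw [enorm_gradient]
  rw [add_comm]
  refine add_le_add ?_ ?_
  · gcongr
    refine le_trans ?_ (mul_le_mul' (le_add_self : N₂ ≤ N₁ + N₂) le_rfl)
    rw [hN₂, ← ENNReal.mul_rpow_of_nonneg _ _ hp0.le]
    refine ENNReal.rpow_le_rpow ?_ hp0.le
    have h1 : ENNReal.ofReal (ρb / (d + 1)) * ENNReal.ofReal (C₁ * M) ≤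
        ENNReal.ofReal (C₁ * θ) * K := by
      rw [hKκ, ← ENNReal.ofReal_mul hL.le, ← ENNReal.ofReal_mul (by positivity)]
      refine ENNReal.ofReal_le_ofReal ?_
      have e : ρb / (d + 1) * (C₁ * M) = C₁ * θ * κ / (d + 1) := by
        rw [hMdef]
        field_simp
      rw [e]
      exact div_le_self (by positivity) (by linarith [Nat.cast_nonneg (α := ℝ) d])
    calc _ = 4 ^ d * d * C₀ * (ENNReal.ofReal (ρb / (d + 1)) * ENNReal.ofReal (C₁ * M)) *
          ENNReal.ofReal p := by ring
      _ ≤ 4 ^ d * d * C₀ * (ENNReal.ofReal (C₁ * θ) * K) * ENNReal.ofReal p := by gcongr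
      _ = _ := by ring
  · have h1 : ENNReal.ofReal (M ^ p) =
        ENNReal.ofReal (θ ^ p) * ENNReal.ofReal (ρb ^ (-p)) * K ^ p := by
      rw [hKκ, ENNReal.ofReal_rpow_of_pos hκ, ← ENNReal.ofReal_mul (by positivity),
        ← ENNReal.ofReal_mul (by positivity), hMdef, Real.div_rpow (by positivity) hρb.le,
        Real.mul_rpow hθ0.le hκ.le, Real.rpow_neg hρb.le]
      congr 1
      ring
    calc _ = N₁ * ENNReal.ofReal (ρb ^ (-p)) * K ^ p * ∫⁻ x, ‖u x‖ₑ ^ p := by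
          rw [h1, hN₁]
          ring
      _ ≤ _ := by
          gcongr
          exact le_self_add
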